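/- Let $(\Omega,\mathcal F,(\mathcal F_t)_{t\ge 0},\mathbb Q)$ be a filtered probability space satisfying the usual conditions and let $W$ be a standard real $(\mathcal F_t)$-Brownian motion. Let $T\ge 0$, and let $K$ be a real function that is absolutely continuous on $[0,T]$ and whose (almost everywhere defined) derivative $K'$ is square-integrable on $[0,T]$. For $t\in[0,T]$ consider the Wiener integrals $$X_t=\int_0^t K(t-s)\,dW_s,\qquad Y_t=\int_0^t K'(t-s)\,dW_s,$$ each of which is determined up to a $\mathbb Q$-null set. Then both are well defined for every $t\in[0,T]$, $X=(X_t)_{t\in[0,T]}$ has a version with almost surely continuous paths, and $Y=(Y_t)_{t\in[0,T]}$ has a progressively measurable version. Moreover, for every version of $X$ with almost surely càdlàg paths and every jointly measurable version of $Y$, the process $X$ is a semimartingale on $[0,T]$ with respect to $(\mathcal F_t)$ (the sum of a càdlàg local martingale and an adapted càdlàg process of finite variation), and its dynamics are $$dX_t=K(0)\,dW_t+\Big(\int_0^t K'(t-s)\,dW_s\Big)dt,\qquad X_0=0,$$ that is, almost surely, $\int_0^T|Y_r|\,dr<\infty$ and, for all $t\in[0,T]$ simultaneously, $$X_t=K(0)W_t+\int_0^t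 Y_r\,dr .$$ -/

import Mathlib

open MeasureTheory ProbabilityTheory Set Filter
open scoped NNReal ENNReal Topology

noncomputable section

namespace GaussianVolterra

/-- The usual conditions for a filtration indexed by `[0, ∞)`: right-continuity, and every
`P`-null set (measurable or not) belongs to `𝓕 0`. -/
structure UsualConditions {Ω : Type*} {mΩ : MeasurableSpace Ω} (𝓕 : Filtration ℝ≥0 mΩ)
    (P : Measure Ω) : Prop where
  rightContinuous : 𝓕.IsRightContinuous
  complete : ∀ A : Set Ω, P A = 0 → MeasurableSet[𝓕 0] A

/-- `W` is a standard real Brownian motion with respect to the filtration `𝓕`. -/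
structure IsBrownianMotion {Ω : Type*} {mΩ : MeasurableSpace Ω} (W : ℝ≥0 → Ω → ℝ)
    (𝓕 : Filtration ℝ≥0 mΩ) (P : Measure Ω) : Prop extends IsBrownianReal W P where
  adapted : StronglyAdapted 𝓕 W
  indep : ∀ s t : ℝ≥0, s ≤ t →
    Indep (MeasurableSpace.comap (fun ω ↦ W t ω - W s ω) inferInstance) (𝓕 s) P

/-! ### The Wiener integral -/

/-- The space `L²((0, ∞))` of deterministic square-integrable integrands. -/
abbrev Integrands : Type := Lp ℝ 2 ((volume : Measure ℝ).restrict (Ioi 0))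

/-- The step function `∑ cᵢ 1_{(0, tᵢ]}`, where `c` is the finitely supported family `tᵢ ↦ cᵢ`. -/
def stepFunction : (ℝ≥0 →₀ ℝ) →ₗ[ℝ] Integrands :=
  Finsupp.linearCombination ℝ fun t : ℝ≥0 ↦
    indicatorConstLp (μ := (volume : Measure ℝ).restrict (Ioi 0)) 2
      (measurableSet_Ioc (a := (0 : ℝ)) (b := (t : ℝ)))
      (((Measure.restrict_apply_le _ _).trans_lt measure_Ioc_lt_top).ne) (1 : ℝ)

theorem memLp_eval {Ω : Type*} {mΩ : MeasurableSpace Ω} {W : ℝ≥0 → Ω → ℝ} {P : Measure Ω}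
    (hW : IsPreBrownianReal W P) (t : ℝ≥0) : MemLp (W t) 2 P :=
  (hW.isGaussianProcess.hasGaussianLaw_eval t).memLp_two

/-- The integral `∑ cᵢ W_{tᵢ}` of the step function `∑ cᵢ 1_{(0, tᵢ]}` (recall `W_0 = 0`). -/
def stepIntegral {Ω : Type*} {mΩ : MeasurableSpace Ω} {W : ℝ≥0 → Ω → ℝ} {P : Measure Ω}
    (hW : IsPreBrownianReal W P) : (ℝ≥0 →₀ ℝ) →ₗ[ℝ] Lp ℝ 2 P :=
  Finsupp.linearCombination ℝ fun t : ℝ≥0 ↦ (memLp_eval hW t).toLp (W t)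

/-- The Wiener integral `f ↦ ∫_0^∞ f(s) dW_s`: the continuous linear extension of the integral of
step functions from the dense subspace of step functions to all of `L²((0, ∞))`. -/
def wienerIntegral {Ω : Type*} {mΩ : MeasurableSpace Ω} {W : ℝ≥0 → Ω → ℝ} {P : Measure Ω}
    (hW : IsPreBrownianReal W P) : Integrands →L[ℝ] Lp ℝ 2 P :=
  (stepIntegral hW).extendOfNorm stepFunction

/-- Step functions are dense in `L²((0, ∞))`. -/
theorem denseRange_stepFunction : DenseRange stepFunction := by
  have key : (LinearMap.range stepFunction).topologicalClosure = ⊤ := by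
    rw [Submodule.topologicalClosure_eq_top_iff, Submodule.eq_bot_iff]
    intro g hg
    rw [Submodule.mem_orthogonal] at hg
    have h0 (t : ℝ≥0) : ∫ s in Ioc (0 : ℝ) t, (Ioi (0 : ℝ)).indicator g s = 0 := by
      have h := hg (stepFunction (Finsupp.single t 1)) ⟨_, rfl⟩
      rw [stepFunction, Finsupp.linearCombination_single, one_smul,
        L2.inner_indicatorConstLp_one, Measure.restrict_restrict measurableSet_Ioc,
        inter_eq_left.2 (fun x hx ↦ hx.1)] at h
      exact (setIntegral_congr_fun measurableSet_Ioc fun x hx ↦ indicator_of_mem hx.1 _).trans h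
    set G : ℝ → ℝ := (Ioi (0 : ℝ)).indicator g with hG
    have hGm : MemLp G 2 volume := (memLp_indicator_iff_restrict measurableSet_Ioi).2 (Lp.memLp g)
    have hGl : LocallyIntegrable G volume := hGm.locallyIntegrable (by norm_num)
    have hint (x : ℝ) : ∫ s in (0 : ℝ)..x, G s = 0 := by
      rcases le_total 0 x with hx | hx
      · rw [intervalIntegral.integral_of_le hx]
        exact h0 ⟨x, hx⟩
      · rw [intervalIntegral.integral_of_ge hx, neg_eq_zero]
        refine setIntegral_eq_zero_of_forall_eq_zero fun s hs ↦ ?_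
        exact indicator_of_notMem (not_lt.2 hs.2) _
    have hae : ∀ᵐ x : ℝ, G x = 0 := by
      filter_upwards [LocallyIntegrable.ae_hasDerivAt_integral hGl] with x hx
      have h1 := hx 0
      simp only [hint] at h1
      exact h1.unique (hasDerivAt_const x 0)
    rw [Lp.eq_zero_iff_ae_eq_zero]
    rw [EventuallyEq, ae_restrict_iff' measurableSet_Ioi]
    filter_upwards [hae] with x hx hx0
    simpa [hG, indicator_of_mem hx0] using hx
  rw [DenseRange, ← LinearMap.coe_range, ← dense_closure]
  have := congrArg (fun S : Submodule ℝ Integrands ↦ (S : Set Integrands)) key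
  simp only [Submodule.topologicalClosure_coe, Submodule.top_coe] at this
  rw [this]
  exact dense_univ

/-- The integral of step functions is an isometry. -/
theorem norm_stepIntegral {Ω : Type*} {mΩ : MeasurableSpace Ω} {W : ℝ≥0 → Ω → ℝ} {P : Measure Ω}
    (hW : IsPreBrownianReal W P) (c : ℝ≥0 →₀ ℝ) : ‖stepIntegral hW c‖ = ‖stepFunction c‖ := by
  have := hW.isGaussianProcess.isProbabilityMeasure
  have hP (s t : ℝ≥0) : inner ℝ ((memLp_eval hW s).toLp (W s)) ((memLp_eval hW t).toLp (W t))
      = ((min s t : ℝ≥0) : ℝ) := by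
    rw [L2.inner_def, ← hW.covariance_eval s t,
      covariance_eq_sub (memLp_eval hW s) (memLp_eval hW t), hW.integral_eval, zero_mul, sub_zero]
    refine integral_congr_ae ?_
    filter_upwards [(memLp_eval hW s).coeFn_toLp, (memLp_eval hW t).coeFn_toLp] with ω h1 h2
    simp [h1, h2, mul_comm]
  have hsq : inner ℝ (stepIntegral hW c) (stepIntegral hW c)
      = inner ℝ (stepFunction c) (stepFunction c) := by
    simp only [stepIntegral, stepFunction, Finsupp.linearCombination_apply, Finsupp.sum_inner,
      Finsupp.inner_sum, inner_smul_left, inner_smul_right, hP,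
      L2.real_inner_indicatorConstLp_one_indicatorConstLp_one]
    refine Finsupp.sum_congr fun s _ ↦ congrArg _ (Finsupp.sum_congr fun t _ ↦ congrArg _ ?_)
    rw [measureReal_restrict_apply (measurableSet_Ioc.inter measurableSet_Ioc), Ioc_inter_Ioc,
      max_self, inter_eq_left.2 (Ioc_subset_Ioi_self)]
    simp [Real.volume_real_Ioc]
  rw [real_inner_self_eq_norm_sq, real_inner_self_eq_norm_sq] at hsq
  exact (sq_eq_sq₀ (norm_nonneg _) (norm_nonneg _)).1 hsq

/-- The Wiener integral extends the integral of step functions. -/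
theorem wienerIntegral_stepFunction {Ω : Type*} {mΩ : MeasurableSpace Ω} {W : ℝ≥0 → Ω → ℝ}
    {P : Measure Ω} (hW : IsPreBrownianReal W P) (c : ℝ≥0 →₀ ℝ) :
    wienerIntegral hW (stepFunction c) = stepIntegral hW c :=
  LinearMap.extendOfNorm_eq denseRange_stepFunction
    ⟨1, fun c ↦ by rw [one_mul, norm_stepIntegral hW c]⟩ c

/-- The random variable `Y` is (a version of) `∫_0^t f(s) dW_s`; in particular `f` is
square-integrable on `(0, t]`. -/
def IsWienerIntegral {Ω : Type*} {mΩ : MeasurableSpace Ω} {W : ℝ≥0 → Ω → ℝ} {P : Measure Ω}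
    (hW : IsPreBrownianReal W P) (f : ℝ → ℝ) (t : ℝ≥0) (Y : Ω → ℝ) : Prop :=
  ∃ hf : MemLp ((Ioc (0 : ℝ) t).indicator f) 2 ((volume : Measure ℝ).restrict (Ioi 0)),
    Y =ᵐ[P] wienerIntegral hW (hf.toLp _)

/-- On the time interval `[0, T]`, the process `X` is (a version of) the Gaussian Volterra process
`t ↦ ∫_0^t k(t - s) dW_s`. -/
def IsVolterraProcess {Ω : Type*} {mΩ : MeasurableSpace Ω} {W : ℝ≥0 → Ω → ℝ} {P : Measure Ω}
    (hW : IsPreBrownianReal W P) (k : ℝ → ℝ) (T : ℝ≥0) (X : ℝ≥0 → Ω → ℝ) : Prop :=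
  ∀ t : ℝ≥0, t ≤ T → IsWienerIntegral hW (fun s ↦ k (t - s)) t (X t)

/-! ### Semimartingales -/

/-- Right-continuous with left limits. -/
def IsCadlag (x : ℝ≥0 → ℝ) : Prop :=
  ∀ t, ContinuousWithinAt x (Ici t) t ∧ ∃ l, Tendsto x (𝓝[<] t) (𝓝 l)

/-- Càdlàg local martingales. -/
def IsLocalMartingale {Ω : Type*} {mΩ : MeasurableSpace Ω} (M : ℝ≥0 → Ω → ℝ)
    (𝓕 : Filtration ℝ≥0 mΩ) (P : Measure Ω) : Prop :=
  Locally (fun N ↦ Martingale N 𝓕 P ∧ ∀ᵐ ω ∂P, IsCadlag (N · ω)) 𝓕 M P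

/-- Adapted càdlàg processes with paths of finite variation on compact intervals. -/
structure IsFiniteVariationProcess {Ω : Type*} {mΩ : MeasurableSpace Ω} (A : ℝ≥0 → Ω → ℝ)
    (𝓕 : Filtration ℝ≥0 mΩ) (P : Measure Ω) : Prop where
  adapted : StronglyAdapted 𝓕 A
  cadlag : ∀ᵐ ω ∂P, IsCadlag (A · ω)
  finiteVariation : ∀ᵐ ω ∂P, LocallyBoundedVariationOn (A · ω) univ

/-- `X` is, up to indistinguishability, the sum of a local martingale and a process of finite
variation. -/
def IsSemimartingale {Ω : Type*} {mΩ : MeasurableSpace Ω} (X : ℝ≥0 → Ω → ℝ)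
    (𝓕 : Filtration ℝ≥0 mΩ) (P : Measure Ω) : Prop :=
  ∃ M A : ℝ≥0 → Ω → ℝ, IsLocalMartingale M 𝓕 P ∧ IsFiniteVariationProcess A 𝓕 P ∧
    ∀ᵐ ω ∂P, ∀ t, X t ω = M t ω + A t ω

/-- The process `X` considered on `[0, T]`, continued by the constant value `X_T` after `T`. -/
def upTo {Ω : Type*} (T : ℝ≥0) (X : ℝ≥0 → Ω → ℝ) : ℝ≥0 → Ω → ℝ := fun t ω ↦ X (min t T) ω

end GaussianVolterra

end

/-!
On `[0, T]` the kernel is `K u = K 0 + ∫ v in 0..u, g v`, so the integrand at time `t` is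
`1_{(0, t]} K(t - ·) = K 0 • 1_{(0, t]} + ∫ r in 0..t, 1_{(0, r]} g(r - ·)`, where the last term is
the Bochner integral of a continuous curve in `L²`: up to restriction to `(0, ∞)`, it consists of
the translates of `g` extended by zero. The Wiener integral is a continuous linear map, so it
commutes with the Bochner integral, and Bochner integrals in `Lᵖ` can be computed pointwise along
any jointly measurable version of the curve. This is the stochastic Fubini theorem at each fixed
time. Both sides are right-continuous in time, so equality at countably many dense times gives it
at all times simultaneously.
-/

noncomputable section

namespace GaussianVolterra

section LpCurves

variable {α β F : Type*} {mα : MeasurableSpace α} {mβ : MeasurableSpace β} {ν : Measure α}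
  {μ : Measure β} [NormedAddCommGroup F] {p : ℝ≥0∞} [Fact (1 ≤ p)]

theorem integrableOn_Lp {A : Set β} (hA : μ A ≠ ∞) (y : Lp F p μ) : IntegrableOn y A μ :=
  have := isFiniteMeasure_restrict.2 hA
  ((Lp.memLp y).restrict A).integrable Fact.out

theorem setIntegral_norm_le_mul_norm_Lp {A : Set β} (hA : μ A ≠ ∞) (y : Lp F p μ) :
    ∫ b in A, ‖y b‖ ∂μ ≤ μ.real A ^ (1 - 1 / p.toReal) * ‖y‖ := by
  have hp : 1 ≤ p := Fact.out
  have hle : eLpNorm y 1 (μ.restrict A) ≤ eLpNorm y p μ * μ A ^ (1 - 1 / p.toReal) := by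
    refine (eLpNorm_le_eLpNorm_mul_rpow_measure_univ hp
      (Lp.aestronglyMeasurable y).restrict).trans ?_
    rw [Measure.restrict_apply_univ, ENNReal.toReal_one, one_div_one]
    gcongr
    exact Measure.restrict_le_self
  have hexp : 0 ≤ 1 - 1 / p.toReal := by
    rcases eq_or_ne p ∞ with rfl | hp_top
    · simp
    · rw [one_div, sub_nonneg]
      exact inv_le_one_of_one_le₀ (ENNReal.toReal_one ▸ ENNReal.toReal_mono hp_top hp)
  rw [integral_norm_eq_lintegral_enorm (Lp.aestronglyMeasurable y).restrict,
    ← eLpNorm_one_eq_lintegral_enorm, mul_comm, Lp.norm_def, measureReal_def, ENNReal.toReal_rpow,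
    ← ENNReal.toReal_mul]
  exact ENNReal.toReal_mono
    (ENNReal.mul_ne_top (Lp.eLpNorm_ne_top y) (ENNReal.rpow_ne_top_of_nonneg hexp hA)) hle

section Fubini

variable {Y : α → β → F} {y : α → Lp F p μ}

theorem integrable_uncurry_restrict_of_ae_eq_Lp [SFinite μ]
    (hY : AEStronglyMeasurable (Function.uncurry Y) (ν.prod μ)) (hy : Integrable y ν)
    (hYy : ∀ᵐ a ∂ν, Y a =ᵐ[μ] y a) {A : Set β} (hA : μ A ≠ ∞) :
    Integrable (Function.uncurry Y) (ν.prod (μ.restrict A)) := by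
  have hYA : AEStronglyMeasurable (Function.uncurry Y) (ν.prod (μ.restrict A)) :=
    hY.mono_ac (Measure.AbsolutelyContinuous.rfl.prod Measure.absolutelyContinuous_restrict)
  refine (integrable_prod_iff hYA).2 ⟨?_, ?_⟩
  · filter_upwards [hYy] with a ha
    exact (integrableOn_Lp hA (y a)).congr (ae_restrict_of_ae ha.symm)
  · refine (hy.norm.const_mul (μ.real A ^ (1 - 1 / p.toReal))).mono'
      hYA.norm.integral_prod_right' ?_
    filter_upwards [hYy] with a ha
    rw [Real.norm_of_nonneg (integral_nonneg fun _ ↦ norm_nonneg _)]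
    refine (integral_congr_ae (ae_restrict_of_ae ?_)).trans_le
      (setIntegral_norm_le_mul_norm_Lp hA (y a))
    exact ha.fun_comp norm

theorem ae_integrable_of_ae_eq_Lp [SFinite ν] [SigmaFinite μ]
    (hY : AEStronglyMeasurable (Function.uncurry Y) (ν.prod μ)) (hy : Integrable y ν)
    (hYy : ∀ᵐ a ∂ν, Y a =ᵐ[μ] y a) :
    ∀ᵐ b ∂μ, Integrable (Y · b) ν :=
  ae_of_forall_measure_lt_top_ae_restrict _ fun _ _ hA ↦
    (integrable_uncurry_restrict_of_ae_eq_Lp hY hy hYy hA.ne).prod_left_ae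

variable [NormedSpace ℝ F]

/-- Integration over a set of finite measure, as a continuous linear map on `Lᵖ`. -/
def setIntegralLp (p : ℝ≥0∞) [Fact (1 ≤ p)] {A : Set β} (hA : μ A ≠ ∞) : Lp F p μ →L[ℝ] F :=
  LinearMap.mkContinuous
    { toFun := fun y ↦ ∫ b in A, y b ∂μ
      map_add' := fun y z ↦ by
        rw [integral_congr_ae (ae_restrict_of_ae (Lp.coeFn_add y z))]
        exact integral_add (integrableOn_Lp hA y) (integrableOn_Lp hA z)
      map_smul' := fun c y ↦ by
        rw [integral_congr_ae (ae_restrict_of_ae (Lp.coeFn_smul c y))]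
        exact integral_smul c _ }
    (μ.real A ^ (1 - 1 / p.toReal))
    fun y ↦ (norm_integral_le_integral_norm _).trans (setIntegral_norm_le_mul_norm_Lp hA y)

theorem setIntegralLp_apply {A : Set β} (hA : μ A ≠ ∞) (y : Lp F p μ) :
    setIntegralLp p hA y = ∫ b in A, y b ∂μ :=
  rfl

theorem coeFn_integral_Lp [SFinite ν] [SigmaFinite μ] [CompleteSpace F]
    (hY : AEStronglyMeasurable (Function.uncurry Y) (ν.prod μ)) (hy : Integrable y ν)
    (hYy : ∀ᵐ a ∂ν, Y a =ᵐ[μ] y a) :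
    ⇑(∫ a, y a ∂ν) =ᵐ[μ] fun b ↦ ∫ a, Y a b ∂ν := by
  have hint {A : Set β} (hA : μ A < ∞) :=
    integrable_uncurry_restrict_of_ae_eq_Lp hY hy hYy hA.ne
  refine ae_eq_of_forall_setIntegral_eq_of_sigmaFinite
    (fun A _ hA ↦ integrableOn_Lp hA.ne _) (fun A _ hA ↦ (hint hA).integral_prod_right)
    fun A _ hA ↦ ?_
  calc ∫ b in A, (∫ a, y a ∂ν : Lp F p μ) b ∂μ
      = ∫ a, ∫ b in A, y a b ∂μ ∂ν := by
        simp only [← setIntegralLp_apply hA.ne]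
        exact ((setIntegralLp p hA.ne).integral_comp_comm hy).symm
    _ = ∫ a, ∫ b in A, Y a b ∂μ ∂ν :=
        integral_congr_ae (hYy.mono fun a ha ↦ integral_congr_ae (ae_restrict_of_ae ha.symm))
    _ = ∫ b in A, ∫ a, Y a b ∂ν ∂μ := integral_integral_swap (hint hA)

end Fubini

end LpCurves

section ProgressiveVersions

variable {Ω β E : Type*} {mΩ : MeasurableSpace Ω} {𝓕 : Filtration ℝ≥0 mΩ} {P : Measure Ω}

/-- The time `t` rounded down to the grid `δℕ`, used to discretize processes; for `δ = 0` this
is `0`. -/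
def gridFloor (δ t : ℝ≥0) : ℝ≥0 := ⌊t / δ⌋₊ * δ

theorem gridFloor_le (δ t : ℝ≥0) : gridFloor δ t ≤ t :=
  mul_le_of_le_div₀ zero_le zero_le (Nat.floor_le zero_le)

theorem le_gridFloor_add {δ : ℝ≥0} (hδ : 0 < δ) (t : ℝ≥0) : t ≤ gridFloor δ t + δ :=
  calc t = t / δ * δ := (div_mul_cancel₀ t hδ.ne').symm
    _ ≤ (⌊t / δ⌋₊ + 1) * δ := by gcongr; exact (Nat.lt_floor_add_one _).le
    _ = gridFloor δ t + δ := by rw [add_one_mul, gridFloor]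

theorem dist_gridFloor_le {δ : ℝ≥0} (hδ : 0 < δ) (t : ℝ≥0) : dist (gridFloor δ t) t ≤ δ := by
  have hlower : (gridFloor δ t : ℝ) ≤ t := gridFloor_le δ t
  have hupper : (t : ℝ) ≤ gridFloor δ t + δ := le_gridFloor_add hδ t
  rw [NNReal.dist_eq, abs_sub_comm, abs_of_nonneg (sub_nonneg.2 hlower)]
  exact sub_le_iff_le_add'.2 hupper

theorem exists_dist_gridFloor_lt [PseudoMetricSpace β] {f : ℝ≥0 → β} (hf : Continuous f)
    (T : ℝ≥0) {ε : ℝ} (hε : 0 < ε) :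
    ∃ δ, ∀ t ≤ T, dist (f (gridFloor δ t)) (f t) < ε := by
  obtain ⟨δ, hδ, h⟩ := Metric.uniformContinuousOn_iff_le.1
    (isCompact_Icc.uniformContinuousOn_of_continuous (hf.continuousOn (s := Icc 0 T)))
    (ε / 2) (half_pos hε)
  lift δ to ℝ≥0 using hδ.le
  refine ⟨δ, fun t ht ↦ (h _ ⟨zero_le, (gridFloor_le δ t).trans ht⟩ _ ⟨zero_le, ht⟩
    (dist_gridFloor_le (mod_cast hδ) t)).trans_lt (half_lt_self hε)⟩

theorem isStronglyProgressive_gridFloor [TopologicalSpace β]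
    [TopologicalSpace.PseudoMetrizableSpace β] {Z : ℝ≥0 → Ω → β} (hZ : StronglyAdapted 𝓕 Z)
    (δ : ℝ≥0) : IsStronglyProgressive 𝓕 fun t ↦ Z (gridFloor δ t) := by
  intro i
  let _ : MeasurableSpace Ω := 𝓕 i
  have hgrid : StronglyMeasurable (Function.uncurry fun (k : ℕ) ω ↦ Z (min (k * δ) i) ω) :=
    stronglyMeasurable_uncurry_of_continuous_of_stronglyMeasurable
      (fun _ ↦ continuous_of_discreteTopology)
      fun k ↦ (hZ _).mono (𝓕.mono (min_le_right _ _))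
  have hindex : Measurable fun q : Iic i × Ω ↦ (⌊(q.1 : ℝ≥0) / δ⌋₊, q.2) :=
    (Nat.measurable_floor.comp (measurable_fst.subtype_val.div_const δ)).prodMk measurable_snd
  refine (congrArg StronglyMeasurable (funext fun q ↦ ?_)).mpr (hgrid.comp_measurable hindex)
  exact congrArg (Z · q.2) (min_eq_left ((gridFloor_le δ _).trans q.1.2)).symm

theorem ae_tendsto_of_summable_dist_Lp [NormedAddCommGroup E] {p : ℝ≥0∞} [Fact (1 ≤ p)]
    {f : ℕ → Lp E p P} {g : Lp E p P} (h : Summable fun n ↦ dist (f n) g) :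
    ∀ᵐ ω ∂P, Tendsto (fun n ↦ f n ω) atTop (𝓝 (g ω)) := by
  have hsum : ∑' n, eLpNorm (f n - g : Lp E p P) p P ≠ ∞ := by
    simp only [← Lp.enorm_def]
    exact tsum_enorm_ne_top_iff_summable_norm.2 (by simpa only [dist_eq_norm] using h)
  filter_upwards [summable_norm_of_tsum_eLpNorm_ne_top Fact.out
    (fun n ↦ Lp.aestronglyMeasurable (f n - g)) hsum, ae_all_iff.2 fun n ↦ Lp.coeFn_sub (f n) g]
    with ω hω hsub
  refine tendsto_iff_norm_sub_tendsto_zero.2 (hω.tendsto_atTop_zero.congr fun n ↦ ?_)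
  rw [hsub n, Pi.sub_apply]

/- The versions are pointwise limits of discretizations along grids so fine that the `Lᵖ` errors
are summable, which makes the limits exist almost surely. -/
theorem exists_isStronglyProgressive_version [NormedAddCommGroup E] [CompleteSpace E]
    {p : ℝ≥0∞} [Fact (1 ≤ p)] {f : ℝ≥0 → Lp E p P} (hf : Continuous f)
    (hm : ∀ t, AEStronglyMeasurable[𝓕 t] (f t) P) :
    ∃ Y : ℝ≥0 → Ω → E, IsStronglyProgressive 𝓕 Y ∧ ∀ t, Y t =ᵐ[P] f t := by
  choose Z hZ hfZ using hm
  choose δ hδ using fun n : ℕ ↦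
    exists_dist_gridFloor_lt hf n (ε := (1 / 2) ^ n) (by positivity)
  refine ⟨fun t ω ↦ limUnder atTop fun n ↦ Z (gridFloor (δ n) t) ω, fun i ↦ ?_, fun t ↦ ?_⟩
  · let _ : MeasurableSpace Ω := 𝓕 i
    exact StronglyMeasurable.limUnder fun n ↦ isStronglyProgressive_gridFloor hZ (δ n) i
  · have hsum : Summable fun n ↦ dist (f (gridFloor (δ n) t)) (f t) := by
      refine summable_geometric_two.of_norm_bounded_eventually_nat ?_
      filter_upwards [eventually_ge_atTop ⌈t⌉₊] with n hn
      rw [Real.norm_of_nonneg dist_nonneg]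
      exact (hδ n t (Nat.ceil_le.1 hn)).le
    filter_upwards [ae_tendsto_of_summable_dist_Lp hsum,
      ae_all_iff.2 fun n ↦ hfZ (gridFloor (δ n) t)] with ω hlim hω
    exact (hlim.congr hω).limUnder_eq

theorem measurable_uncurry_of_isStronglyProgressive [TopologicalSpace β]
    [TopologicalSpace.PseudoMetrizableSpace β] [MeasurableSpace β] [BorelSpace β]
    {Y : ℝ≥0 → Ω → β} (hY : IsStronglyProgressive 𝓕 Y) : Measurable (Function.uncurry Y) := by
  have htrunc (n : ℕ) : Measurable fun q : ℝ≥0 × Ω ↦ Y (min q.1 n) q.2 := by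
    have hYn : Measurable fun q : Iic (n : ℝ≥0) × Ω ↦ Y q.1 q.2 :=
      (hY n).measurable.mono (sup_le_sup le_rfl (MeasurableSpace.comap_mono (𝓕.le _))) le_rfl
    exact hYn.comp (((measurable_fst.min measurable_const).subtype_mk
      (h := fun q ↦ mem_Iic.2 (min_le_right _ _))).prodMk measurable_snd)
  refine measurable_of_tendsto_metrizable htrunc (tendsto_pi_nhds.2 fun q ↦ ?_)
  refine tendsto_const_nhds.congr' ?_
  filter_upwards [eventually_ge_atTop ⌈q.1⌉₊] with n hn
  rw [min_eq_left (Nat.ceil_le.1 hn), Function.uncurry]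

end ProgressiveVersions

section Adaptedness

section IndicatorLp

variable {α F : Type*} {mα : MeasurableSpace α} {μ : Measure α} [NormedAddCommGroup F]
  [NormedSpace ℝ F] {p : ℝ≥0∞} [Fact (1 ≤ p)]

/-- Multiplication by the indicator function of `A`, as a continuous linear map on `Lᵖ`. -/
def indicatorLp {A : Set α} (hA : MeasurableSet A) : Lp F p μ →L[ℝ] Lp F p μ :=
  LinearMap.mkContinuous
    { toFun := fun f ↦ ((Lp.memLp f).indicator hA).toLp _
      map_add' := fun f g ↦ by
        rw [← MemLp.toLp_add, MemLp.toLp_eq_toLp_iff, ← indicator_add']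
        exact (Lp.coeFn_add f g).indicator
      map_smul' := fun c f ↦ by
        rw [RingHom.id_apply, ← MemLp.toLp_const_smul, MemLp.toLp_eq_toLp_iff]
        exact (Lp.coeFn_smul c f).indicator.trans (.of_eq (indicator_const_smul A c f)) }
    1
    fun f ↦ by
      rw [one_mul, Lp.norm_def, Lp.norm_def]
      refine ENNReal.toReal_mono (Lp.eLpNorm_ne_top f) ?_
      exact (eLpNorm_congr_ae ((Lp.memLp f).indicator hA).coeFn_toLp).trans_le
        (eLpNorm_indicator_le _)

theorem coeFn_indicatorLp {A : Set α} (hA : MeasurableSet A) (f : Lp F p μ) :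
    indicatorLp hA f =ᵐ[μ] A.indicator f :=
  ((Lp.memLp f).indicator hA).coeFn_toLp

theorem indicatorLp_eq_self {A : Set α} (hA : MeasurableSet A) {f : Lp F p μ}
    (hf : ∀ᵐ a ∂μ, a ∉ A → f a = 0) : indicatorLp hA f = f := by
  refine Lp.ext ((coeFn_indicatorLp hA _).trans ?_)
  filter_upwards [hf] with a ha
  exact indicator_apply_eq_self.2 ha

theorem indicatorLp_indicatorConstLp {A B : Set α} (hA : MeasurableSet A) (hB : MeasurableSet B)
    (hμB : μ B ≠ ∞) (c : F) :
    indicatorLp hA (indicatorConstLp p hB hμB c)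
      = indicatorConstLp p (hA.inter hB) (measure_ne_top_of_subset inter_subset_right hμB) c := by
  refine Lp.ext ((coeFn_indicatorLp hA _).trans (indicatorConstLp_coeFn.indicator.trans ?_))
  rw [indicator_indicator]
  exact indicatorConstLp_coeFn.symm

end IndicatorLp

theorem stronglyMeasurable_of_aestronglyMeasurable {Ω β : Type*} {m mΩ : MeasurableSpace Ω}
    {P : Measure Ω} [TopologicalSpace β] [TopologicalSpace.PseudoMetrizableSpace β]
    [SecondCountableTopology β] (hm : ∀ A, P A = 0 → MeasurableSet[m] A) {X : Ω → β}
    (hX : AEStronglyMeasurable[m] X P) : StronglyMeasurable[m] X := by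
  borelize β
  obtain ⟨Z, hZ, hXZ⟩ := hX
  have hnull : P {ω | X ω ≠ Z ω} = 0 := hXZ
  refine Measurable.stronglyMeasurable fun B hB ↦ ?_
  have hpre : X ⁻¹' B = (Z ⁻¹' B \ {ω | X ω ≠ Z ω}) ∪ (X ⁻¹' B ∩ {ω | X ω ≠ Z ω}) := by
    ext ω
    by_cases h : X ω = Z ω <;> simp [h]
  rw [hpre]
  exact ((hZ.measurable hB).diff (hm _ hnull)).union
    (hm _ (measure_mono_null inter_subset_right hnull))

theorem indicatorLp_stepFunction (t : ℝ≥0) (c : ℝ≥0 →₀ ℝ) :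
    indicatorLp (measurableSet_Ioc (a := (0 : ℝ)) (b := t)) (stepFunction c)
      = stepFunction (c.mapDomain (min t)) := by
  induction c using Finsupp.induction_linear with
  | zero => simp only [Finsupp.mapDomain_zero, map_zero]
  | add c d hc hd => simp only [Finsupp.mapDomain_add, map_add, hc, hd]
  | single u a =>
    simp only [Finsupp.mapDomain_single, stepFunction, Finsupp.linearCombination_single, map_smul,
      indicatorLp_indicatorConstLp, Ioc_inter_Ioc, max_self, NNReal.coe_min]

variable {Ω : Type*} {mΩ : MeasurableSpace Ω} {W : ℝ≥0 → Ω → ℝ} {P : Measure Ω}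
  {𝓕 : Filtration ℝ≥0 mΩ}

theorem aestronglyMeasurable_stepIntegral_mapDomain_min (hW : IsPreBrownianReal W P)
    (hWa : StronglyAdapted 𝓕 W) (t : ℝ≥0) (c : ℝ≥0 →₀ ℝ) :
    AEStronglyMeasurable[𝓕 t] (stepIntegral hW (c.mapDomain (min t))) P := by
  rw [← mem_lpMeas_iff_aestronglyMeasurable (𝕜 := ℝ), stepIntegral,
    Finsupp.linearCombination_mapDomain]
  refine Submodule.sum_mem _ fun u _ ↦
    Submodule.smul_mem _ _ (mem_lpMeas_iff_aestronglyMeasurable.2 ?_)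
  exact ⟨W (min t u), (hWa _).mono (𝓕.mono (min_le_left _ _)), (memLp_eval hW _).coeFn_toLp⟩

theorem aestronglyMeasurable_wienerIntegral (hW : IsPreBrownianReal W P)
    (hWa : StronglyAdapted 𝓕 W) {t : ℝ≥0} {f : Integrands}
    (hf : ∀ᵐ s ∂(volume : Measure ℝ).restrict (Ioi 0), s ∉ Ioc (0 : ℝ) t → f s = 0) :
    AEStronglyMeasurable[𝓕 t] (wienerIntegral hW f) P := by
  rw [← indicatorLp_eq_self measurableSet_Ioc hf]
  refine denseRange_stepFunction.induction_on (p := fun g ↦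
    AEStronglyMeasurable[𝓕 t] (wienerIntegral hW (indicatorLp measurableSet_Ioc g)) P) f ?_
    fun c ↦ ?_
  · exact (isClosed_aestronglyMeasurable (𝓕.le t)).preimage
      ((wienerIntegral hW).continuous.comp (indicatorLp measurableSet_Ioc).continuous)
  · rw [indicatorLp_stepFunction, wienerIntegral_stepFunction]
    exact aestronglyMeasurable_stepIntegral_mapDomain_min hW hWa t c

theorem IsWienerIntegral.aestronglyMeasurable {hW : IsPreBrownianReal W P}
    (hWa : StronglyAdapted 𝓕 W) {f : ℝ → ℝ} {t : ℝ≥0} {Y : Ω → ℝ}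
    (hY : IsWienerIntegral hW f t Y) : AEStronglyMeasurable[𝓕 t] Y P := by
  obtain ⟨hf, hY⟩ := hY
  refine (aestronglyMeasurable_wienerIntegral hW hWa ?_).congr hY.symm
  filter_upwards [hf.coeFn_toLp] with s hs hst
  rw [hs, indicator_of_notMem hst]

end Adaptedness

section Kernel

/-- The curve `r ↦ k (r - ·)` in `L²((0, ∞))`. -/
def shiftedKernel {k : ℝ → ℝ} (hk : MemLp k 2 volume) (r : ℝ) : Integrands :=
  LpToLpRestrictCLM ℝ ℝ ℝ volume 2 (Ioi 0)
    (Lp.compMeasurePreserving (fun s ↦ r - s) (Measure.measurePreserving_sub_left volume r)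
      (hk.toLp k))

theorem coeFn_shiftedKernel {k : ℝ → ℝ} (hk : MemLp k 2 volume) (r : ℝ) :
    shiftedKernel hk r =ᵐ[(volume : Measure ℝ).restrict (Ioi 0)] fun s ↦ k (r - s) := by
  have hmp := Measure.measurePreserving_sub_left (volume : Measure ℝ) r
  exact (LpToLpRestrictCLM_coeFn ℝ (Ioi 0) _).trans <| ae_restrict_of_ae <|
    (Lp.coeFn_compMeasurePreserving (hk.toLp k) hmp).trans <|
      hmp.quasiMeasurePreserving.ae_eq_comp hk.coeFn_toLp

theorem continuous_shiftedKernel {k : ℝ → ℝ} (hk : MemLp k 2 volume) :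
    Continuous (shiftedKernel hk) := by
  let reflect : ℝ → C(ℝ, ℝ) := (ContinuousMap.mk (fun q : ℝ × ℝ ↦ q.1 - q.2)).curry
  have hcomp : Continuous fun r ↦ Lp.compMeasurePreserving (reflect r)
      (Measure.measurePreserving_sub_left volume r) (hk.toLp k) :=
    continuous_const.compMeasurePreservingLp (ContinuousMap.continuous _)
      (Measure.measurePreserving_sub_left volume) ENNReal.ofNat_ne_top
  exact (LpToLpRestrictCLM ℝ ℝ ℝ volume 2 (Ioi 0)).continuous.comp hcomp

theorem coeFn_intervalIntegral_shiftedKernel {k : ℝ → ℝ} (hk : MemLp k 2 volume) {a b : ℝ}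
    (hab : a ≤ b) :
    ⇑(∫ r in a..b, shiftedKernel hk r) =ᵐ[(volume : Measure ℝ).restrict (Ioi 0)]
      fun s ↦ ∫ r in a..b, k (r - s) := by
  have hmeas : AEStronglyMeasurable (Function.uncurry fun r s ↦ k (r - s))
      ((volume.restrict (Ioc a b)).prod (volume.restrict (Ioi 0))) := by
    refine (hk.1.comp_quasiMeasurePreserving
      (quasiMeasurePreserving_sub volume volume)).mono_ac ?_
    exact Measure.absolutelyContinuous_restrict.prod Measure.absolutelyContinuous_restrict
  simp only [intervalIntegral.integral_of_le hab]
  exact coeFn_integral_Lp hmeas ((continuous_shiftedKernel hk).intervalIntegrable a b).1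
    (ae_of_all _ fun r ↦ (coeFn_shiftedKernel hk r).symm)

variable {g : ℝ → ℝ}

theorem indicator_Ioc_comp_sub {s t T : ℝ} (hs : 0 < s) (htT : t ≤ T) :
    (Ioc 0 t).indicator (fun s ↦ g (t - s)) s = (Icc 0 T).indicator g (t - s) := by
  have hiff : s ∈ Ioc 0 t ↔ t - s ∈ Icc 0 T :=
    ⟨fun h ↦ ⟨sub_nonneg.2 h.2, by linarith⟩, fun h ↦ ⟨hs, sub_nonneg.1 h.1⟩⟩
  simp only [indicator_apply, hiff]

theorem intervalIntegral_indicator_Icc_sub {s t T : ℝ} (hs : 0 < s) (ht : 0 ≤ t) (htT : t ≤ T) :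
    ∫ r in 0..t, (Icc 0 T).indicator g (r - s)
      = (Ioc 0 t).indicator (fun s ↦ ∫ u in 0..(t - s), g u) s := by
  have hinter : Ioc (-s) (t - s) ∩ Ioc 0 T = Ioc 0 (t - s) := by
    rw [Ioc_inter_Ioc, max_eq_right (by linarith), min_eq_left (by linarith)]
  have hset : ∫ r in 0..t, (Icc 0 T).indicator g (r - s) = ∫ u in Ioc 0 (t - s), g u := by
    rw [intervalIntegral.integral_comp_sub_right, zero_sub,
      intervalIntegral.integral_of_le (by linarith), ← hinter,
      ← setIntegral_indicator measurableSet_Ioc]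
    exact integral_congr_ae (ae_restrict_of_ae (indicator_ae_eq_of_ae_eq_set Ioc_ae_eq_Icc.symm))
  rw [hset]
  rcases le_or_gt s t with hst | hst
  · rw [indicator_of_mem (show s ∈ Ioc 0 t from ⟨hs, hst⟩),
      intervalIntegral.integral_of_le (sub_nonneg.2 hst)]
  · rw [indicator_of_notMem fun h ↦ hst.not_ge h.2, Ioc_eq_empty (by linarith), setIntegral_empty]

/-- The curve `t ↦ 1_{(0, t]} g(t - ·)`, `t ≤ T`, of integrands of a Volterra process, for a
kernel `g` that is square-integrable on `[0, T]`. It is obtained by extending `g` by zero, which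
makes it a translation curve. -/
def volterraIntegrand {T : ℝ} (hg : MemLp g 2 ((volume : Measure ℝ).restrict (Icc 0 T))) :
    ℝ → Integrands :=
  shiftedKernel ((memLp_indicator_iff_restrict measurableSet_Icc).2 hg)

variable {T : ℝ} (hg : MemLp g 2 ((volume : Measure ℝ).restrict (Icc 0 T)))

theorem continuous_volterraIntegrand : Continuous (volterraIntegrand hg) :=
  continuous_shiftedKernel _

theorem coeFn_volterraIntegrand {t : ℝ} (htT : t ≤ T) :
    volterraIntegrand hg t =ᵐ[(volume : Measure ℝ).restrict (Ioi 0)]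
      (Ioc 0 t).indicator fun s ↦ g (t - s) := by
  filter_upwards [coeFn_shiftedKernel ((memLp_indicator_iff_restrict measurableSet_Icc).2 hg) t,
    ae_restrict_mem measurableSet_Ioi] with s hs hs0
  exact hs.trans (indicator_Ioc_comp_sub hs0 htT).symm

theorem coeFn_intervalIntegral_volterraIntegrand {t : ℝ} (ht : 0 ≤ t) (htT : t ≤ T) :
    ⇑(∫ r in 0..t, volterraIntegrand hg r) =ᵐ[(volume : Measure ℝ).restrict (Ioi 0)]
      (Ioc 0 t).indicator fun s ↦ ∫ u in 0..(t - s), g u := by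
  filter_upwards [coeFn_intervalIntegral_shiftedKernel
    ((memLp_indicator_iff_restrict measurableSet_Icc).2 hg) ht,
    ae_restrict_mem measurableSet_Ioi] with s hs hs0
  exact hs.trans (intervalIntegral_indicator_Icc_sub hs0 ht htT)

end Kernel

section Volterra

variable {Ω : Type*} {mΩ : MeasurableSpace Ω} {W : ℝ≥0 → Ω → ℝ} {P : Measure Ω}

theorem isWienerIntegral_iff_of_ae_eq {hW : IsPreBrownianReal W P} {f : ℝ → ℝ} {h : Integrands}
    {t : ℝ≥0} {X : Ω → ℝ}
    (hfh : h =ᵐ[(volume : Measure ℝ).restrict (Ioi 0)] (Ioc (0 : ℝ) t).indicator f) :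
    IsWienerIntegral hW f t X ↔ X =ᵐ[P] wienerIntegral hW h := by
  have hf : MemLp ((Ioc (0 : ℝ) t).indicator f) 2 ((volume : Measure ℝ).restrict (Ioi 0)) :=
    (memLp_congr_ae hfh).1 (Lp.memLp h)
  have hLp : hf.toLp _ = h := Lp.ext (hf.coeFn_toLp.trans hfh.symm)
  exact ⟨fun ⟨_, hX⟩ ↦ hLp ▸ hX, fun hX ↦ ⟨hf, hLp ▸ hX⟩⟩

variable {K g : ℝ → ℝ} {t T : ℝ≥0} {Y : ℝ≥0 → Ω → ℝ}

theorem isVolterraProcess_iff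
    (hg : MemLp g 2 ((volume : Measure ℝ).restrict (Icc 0 (T : ℝ))))
    {hW : IsPreBrownianReal W P} :
    IsVolterraProcess hW g T Y ↔
      ∀ t ≤ T, Y t =ᵐ[P] wienerIntegral hW (volterraIntegrand hg t) :=
  forall₂_congr fun _ ht ↦ isWienerIntegral_iff_of_ae_eq
    (coeFn_volterraIntegrand hg (NNReal.coe_le_coe.2 ht))

theorem exists_isStronglyProgressive_isVolterraProcess
    (hg : MemLp g 2 ((volume : Measure ℝ).restrict (Icc 0 (T : ℝ))))
    (hW : IsPreBrownianReal W P) {𝓕 : Filtration ℝ≥0 mΩ} (hWa : StronglyAdapted 𝓕 W) :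
    ∃ Y : ℝ≥0 → Ω → ℝ, IsVolterraProcess hW g T Y ∧ IsStronglyProgressive 𝓕 Y := by
  have hcont : Continuous fun t : ℝ≥0 ↦
      wienerIntegral hW (volterraIntegrand hg (min t T : ℝ≥0)) :=
    (wienerIntegral hW).continuous.comp <| (continuous_volterraIntegrand hg).comp <|
      NNReal.continuous_coe.comp (continuous_id.min continuous_const)
  have hadapted (t : ℝ≥0) : AEStronglyMeasurable[𝓕 t]
      (wienerIntegral hW (volterraIntegrand hg (min t T : ℝ≥0))) P := by
    refine aestronglyMeasurable_wienerIntegral hW hWa ?_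
    filter_upwards [coeFn_volterraIntegrand hg (NNReal.coe_le_coe.2 (min_le_right t T))]
      with s hs hst
    rw [hs]
    exact indicator_of_notMem
      (fun h ↦ hst (Ioc_subset_Ioc_right (NNReal.coe_le_coe.2 (min_le_left t T)) h)) _
  obtain ⟨Y, hY, hYk⟩ := exists_isStronglyProgressive_version hcont hadapted
  refine ⟨Y, (isVolterraProcess_iff hg).2 fun t ht ↦ ?_, hY⟩
  simpa only [min_eq_left ht] using hYk t

theorem coeFn_stepFunction_single (t : ℝ≥0) (c : ℝ) :
    stepFunction (Finsupp.single t c) =ᵐ[(volume : Measure ℝ).restrict (Ioi 0)]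
      (Ioc (0 : ℝ) t).indicator fun _ ↦ c := by
  rw [stepFunction, Finsupp.linearCombination_single]
  refine (Lp.coeFn_smul _ _).trans ((indicatorConstLp_coeFn.const_smul c).trans (.of_eq ?_))
  simp only [Pi.smul_def, smul_eq_mul, ← indicator_const_mul, mul_one]

theorem coeFn_stepFunction_add_intervalIntegral_volterraIntegrand
    (hg : MemLp g 2 ((volume : Measure ℝ).restrict (Icc 0 (T : ℝ))))
    (htT : t ≤ T) (hK : ∀ s ∈ Icc (0 : ℝ) T, K s = K 0 + ∫ r in 0..s, g r) :
    (stepFunction (Finsupp.single t (K 0)) + ∫ r in 0..(t : ℝ), volterraIntegrand hg r : Integrands)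
      =ᵐ[(volume : Measure ℝ).restrict (Ioi 0)]
        (Ioc (0 : ℝ) t).indicator fun s ↦ K (t - s) := by
  have htT' : (t : ℝ) ≤ T := NNReal.coe_le_coe.2 htT
  filter_upwards [Lp.coeFn_add (stepFunction (Finsupp.single t (K 0)))
      (∫ r in 0..(t : ℝ), volterraIntegrand hg r), coeFn_stepFunction_single t (K 0),
    coeFn_intervalIntegral_volterraIntegrand hg t.coe_nonneg htT'] with s hadd hstep hint
  rw [hadd, Pi.add_apply, hstep, hint]
  by_cases hs : s ∈ Ioc (0 : ℝ) t
  · simp only [indicator_of_mem hs]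
    exact (hK (t - s) ⟨sub_nonneg.2 hs.2, by linarith [hs.1]⟩).symm
  · simp only [indicator_of_notMem hs, add_zero]

theorem coeFn_wienerIntegral_stepFunction_single (hW : IsPreBrownianReal W P) (t : ℝ≥0) (c : ℝ) :
    wienerIntegral hW (stepFunction (Finsupp.single t c)) =ᵐ[P] fun ω ↦ c * W t ω := by
  rw [wienerIntegral_stepFunction, stepIntegral, Finsupp.linearCombination_single]
  filter_upwards [Lp.coeFn_smul c ((memLp_eval hW t).toLp (W t)), (memLp_eval hW t).coeFn_toLp]
    with ω hsmul hWt
  rw [hsmul, Pi.smul_apply, hWt, smul_eq_mul]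

theorem aestronglyMeasurable_uncurry_comp_toNNReal (hYm : Measurable (Function.uncurry Y))
    (ν : Measure ℝ) :
    AEStronglyMeasurable (Function.uncurry fun (r : ℝ) ω ↦ Y r.toNNReal ω) (ν.prod P) :=
  (hYm.comp (measurable_real_toNNReal.prodMap measurable_id)).aestronglyMeasurable

theorem IsVolterraProcess.ae_restrict_ae_eq_wienerIntegral
    (hg : MemLp g 2 ((volume : Measure ℝ).restrict (Icc 0 (T : ℝ))))
    {hW : IsPreBrownianReal W P} (hY : IsVolterraProcess hW g T Y) (htT : t ≤ T) :
    ∀ᵐ r ∂(volume : Measure ℝ).restrict (Ioc 0 (t : ℝ)),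
      Y r.toNNReal =ᵐ[P] wienerIntegral hW (volterraIntegrand hg r) := by
  filter_upwards [ae_restrict_mem measurableSet_Ioc] with r hr
  have hrT : r.toNNReal ≤ T := (Real.toNNReal_le_iff_le_coe.2 hr.2).trans htT
  simpa only [Real.coe_toNNReal _ hr.1.le] using (isVolterraProcess_iff hg).1 hY _ hrT

theorem intervalIntegrable_wienerIntegral_volterraIntegrand
    (hg : MemLp g 2 ((volume : Measure ℝ).restrict (Icc 0 (T : ℝ))))
    (hW : IsPreBrownianReal W P) (a b : ℝ) :
    IntervalIntegrable (fun r ↦ wienerIntegral hW (volterraIntegrand hg r)) volume a b :=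
  ((wienerIntegral hW).continuous.comp (continuous_volterraIntegrand hg)).intervalIntegrable a b

theorem IsVolterraProcess.ae_intervalIntegrable
    (hg : MemLp g 2 ((volume : Measure ℝ).restrict (Icc 0 (T : ℝ))))
    {hW : IsPreBrownianReal W P} (hY : IsVolterraProcess hW g T Y)
    (hYm : Measurable (Function.uncurry Y)) :
    ∀ᵐ ω ∂P, IntervalIntegrable (fun r : ℝ ↦ Y r.toNNReal ω) volume 0 T := by
  have := hW.isGaussianProcess.isProbabilityMeasure
  simp only [intervalIntegrable_iff_integrableOn_Ioc_of_le T.coe_nonneg]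
  exact ae_integrable_of_ae_eq_Lp (aestronglyMeasurable_uncurry_comp_toNNReal hYm _)
    (intervalIntegrable_wienerIntegral_volterraIntegrand hg hW 0 T).1
    (hY.ae_restrict_ae_eq_wienerIntegral hg le_rfl)

theorem IsVolterraProcess.coeFn_wienerIntegral_intervalIntegral
    (hg : MemLp g 2 ((volume : Measure ℝ).restrict (Icc 0 (T : ℝ))))
    {hW : IsPreBrownianReal W P} (hY : IsVolterraProcess hW g T Y)
    (hYm : Measurable (Function.uncurry Y)) (htT : t ≤ T) :
    wienerIntegral hW (∫ r in 0..(t : ℝ), volterraIntegrand hg r)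
      =ᵐ[P] fun ω ↦ ∫ r in 0..(t : ℝ), Y r.toNNReal ω := by
  have := hW.isGaussianProcess.isProbabilityMeasure
  rw [← ContinuousLinearMap.intervalIntegral_comp_comm _
    ((continuous_volterraIntegrand hg).intervalIntegrable _ _)]
  simp only [intervalIntegral.integral_of_le t.coe_nonneg]
  exact coeFn_integral_Lp (aestronglyMeasurable_uncurry_comp_toNNReal hYm _)
    (intervalIntegrable_wienerIntegral_volterraIntegrand hg hW 0 t).1
    (hY.ae_restrict_ae_eq_wienerIntegral hg htT)

theorem isWienerIntegral_iff_ae_eq_mul_add_intervalIntegral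
    (hg : MemLp g 2 ((volume : Measure ℝ).restrict (Icc 0 (T : ℝ))))
    {hW : IsPreBrownianReal W P}
    (hK : ∀ s ∈ Icc (0 : ℝ) T, K s = K 0 + ∫ r in 0..s, g r)
    (hY : IsVolterraProcess hW g T Y) (hYm : Measurable (Function.uncurry Y)) (htT : t ≤ T)
    {X : Ω → ℝ} :
    IsWienerIntegral hW (fun s ↦ K (t - s)) t X ↔
      X =ᵐ[P] fun ω ↦ K 0 * W t ω + ∫ r in 0..(t : ℝ), Y r.toNNReal ω := by
  have hfubini : wienerIntegral hW (stepFunction (Finsupp.single t (K 0))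
      + ∫ r in 0..(t : ℝ), volterraIntegrand hg r)
      =ᵐ[P] fun ω ↦ K 0 * W t ω + ∫ r in 0..(t : ℝ), Y r.toNNReal ω := by
    rw [map_add]
    exact (Lp.coeFn_add _ _).trans ((coeFn_wienerIntegral_stepFunction_single hW t (K 0)).add
      (hY.coeFn_wienerIntegral_intervalIntegral hg hYm htT))
  exact (isWienerIntegral_iff_of_ae_eq
    (coeFn_stepFunction_add_intervalIntegral_volterraIntegrand hg htT hK)).trans
    ⟨fun h ↦ h.trans hfubini, fun h ↦ h.trans hfubini.symm⟩

end Volterra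

section Paths

theorem isCadlag_of_continuous {x : ℝ≥0 → ℝ} (hx : Continuous x) : IsCadlag x :=
  fun t ↦ ⟨hx.continuousWithinAt, x t, hx.continuousWithinAt⟩

theorem eq_of_eqOn_dense_of_continuousWithinAt_Ici {α β : Type*} [TopologicalSpace α]
    [LinearOrder α] [OrderTopology α] [DenselyOrdered α] [NoMaxOrder α] [TopologicalSpace β]
    [T2Space β] {x y : α → β} {D : Set α} (hD : Dense D)
    (hx : ∀ t, ContinuousWithinAt x (Ici t) t) (hy : ∀ t, ContinuousWithinAt y (Ici t) t)
    (hxy : EqOn x y D) : x = y := by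
  funext t
  have hmem : t ∈ closure (Ioi t ∩ D) :=
    closure_minimal (hD.open_subset_closure_inter isOpen_Ioi) isClosed_closure
      (by rw [closure_Ioi]; exact self_mem_Ici)
  have := mem_closure_iff_nhdsWithin_neBot.1 hmem
  have hsub : Ioi t ∩ D ⊆ Ici t := inter_subset_left.trans Ioi_subset_Ici_self
  refine tendsto_nhds_unique_of_eventuallyEq ((hx t).mono hsub) ((hy t).mono hsub) ?_
  filter_upwards [self_mem_nhdsWithin] with s hs using hxy hs.2

theorem eq_add_intervalIntegral_deriv {f : ℝ → ℝ} {a b x : ℝ}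
    (hf : AbsolutelyContinuousOnInterval f a b) (hx : x ∈ uIcc a b) :
    f x = f a + ∫ r in a..x, deriv f r := by
  have hfx : AbsolutelyContinuousOnInterval f a x := hf.mono (uIcc_subset_uIcc_left hx)
  rw [hfx.integral_deriv_eq_sub, add_sub_cancel]

variable {f : ℝ → ℝ} {T : ℝ≥0}

theorem coe_min_mem_uIcc (t T : ℝ≥0) : ((min t T : ℝ≥0) : ℝ) ∈ uIcc (0 : ℝ) T :=
  mem_uIcc_of_le (NNReal.coe_nonneg _) (NNReal.coe_le_coe.2 (min_le_right _ _))

theorem continuous_primitive_min (hf : IntervalIntegrable f volume 0 T) :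
    Continuous fun t : ℝ≥0 ↦ ∫ r in 0..((min t T : ℝ≥0) : ℝ), f r :=
  (intervalIntegral.continuousOn_primitive_interval' hf left_mem_uIcc).comp_continuous
    (NNReal.continuous_coe.comp (continuous_id.min continuous_const)) fun t ↦ coe_min_mem_uIcc t T

theorem boundedVariationOn_primitive_min (hf : IntervalIntegrable f volume 0 T) :
    BoundedVariationOn (fun t : ℝ≥0 ↦ ∫ r in 0..((min t T : ℝ≥0) : ℝ), f r) univ := by
  have hbv := (hf.absolutelyContinuousOnInterval_intervalIntegral left_mem_uIcc).boundedVariationOn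
  refine ne_top_of_le_ne_top hbv (eVariationOn.comp_le_of_monotoneOn _
    (fun t : ℝ≥0 ↦ ((min t T : ℝ≥0) : ℝ)) ?_ fun t _ ↦ coe_min_mem_uIcc t T)
  exact fun s _ t _ hst ↦ NNReal.coe_le_coe.2 (min_le_min_right _ hst)

end Paths

section Semimartingales

variable {Ω : Type*} {mΩ : MeasurableSpace Ω} {P : Measure Ω}

theorem martingale_of_indep_sub {ι E : Type*} [Preorder ι] [NormedAddCommGroup E]
    [NormedSpace ℝ E] [CompleteSpace E] [SecondCountableTopology E] [MeasurableSpace E]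
    [BorelSpace E] {𝓕 : Filtration ι mΩ} [SigmaFiniteFiltration P 𝓕] {M : ι → Ω → E}
    (hM : StronglyAdapted 𝓕 M) (hint : ∀ t, Integrable (M t) P)
    (hmean : ∀ s t, s ≤ t → ∫ ω, M t ω ∂P = ∫ ω, M s ω ∂P)
    (hindep : ∀ s t, s ≤ t →
      Indep (MeasurableSpace.comap (fun ω ↦ M t ω - M s ω) inferInstance) (𝓕 s) P) :
    Martingale M 𝓕 P := by
  refine ⟨hM, fun s t hst ↦ ?_⟩
  have hmeas (u : ι) : Measurable (M u) := ((hM u).mono (𝓕.le u)).measurable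
  have hincr : P[M t - M s | 𝓕 s] =ᵐ[P] 0 := by
    refine (condExp_indep_eq ((hmeas t).sub (hmeas s)).comap_le (𝓕.le s)
      (comap_measurable _).stronglyMeasurable (hindep s t hst)).trans (.of_eq ?_)
    funext _
    simp only [Pi.sub_apply, integral_sub (hint t) (hint s), hmean s t hst, sub_self,
      Pi.zero_apply]
  have hpast : P[M s | 𝓕 s] = M s := condExp_of_stronglyMeasurable (𝓕.le s) (hM s) (hint s)
  have hsub := (condExp_sub (hint t) (hint s) (𝓕 s)).symm.trans hincr
  rw [hpast] at hsub
  exact hsub.mono fun _ hω ↦ sub_eq_zero.1 hω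

theorem IsBrownianMotion.martingale {𝓕 : Filtration ℝ≥0 mΩ} {W : ℝ≥0 → Ω → ℝ}
    (hW : IsBrownianMotion W 𝓕 P) : Martingale W 𝓕 P :=
  have := hW.isGaussianProcess.isProbabilityMeasure
  martingale_of_indep_sub hW.adapted hW.integrable_eval
    (fun s t _ ↦ (hW.integral_eval t).trans (hW.integral_eval s).symm) hW.indep

variable {𝓕 : Filtration ℝ≥0 mΩ} [SigmaFiniteFiltration P 𝓕] {M X : ℝ≥0 → Ω → ℝ} {T : ℝ≥0}

theorem martingale_upTo (hM : Martingale M 𝓕 P) (T : ℝ≥0) : Martingale (upTo T M) 𝓕 P := by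
  refine ⟨fun t ↦ (hM.stronglyMeasurable _).mono (𝓕.mono (min_le_left t T)), fun s t hst ↦ ?_⟩
  change P[M (min t T) | 𝓕 s] =ᵐ[P] M (min s T)
  rcases le_total s T with hs | hs
  · rw [min_eq_left hs]
    exact hM.condExp_ae_eq (le_min hst hs)
  · rw [min_eq_right hs, min_eq_right (hs.trans hst), condExp_of_stronglyMeasurable (𝓕.le s)
      ((hM.stronglyMeasurable T).mono (𝓕.mono hs)) (hM.integrable T)]

theorem continuous_upTo {ω : Ω} (hX : Continuous (X · ω)) : Continuous (upTo T X · ω) :=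
  hX.comp (continuous_id.min continuous_const)

theorem isSemimartingale_upTo_of_ae_eq_add_intervalIntegral {f : ℝ → Ω → ℝ}
    (hM : Martingale M 𝓕 P) (hMc : ∀ᵐ ω ∂P, Continuous (M · ω))
    (hf : ∀ᵐ ω ∂P, IntervalIntegrable (f · ω) volume 0 T)
    (hXm : ∀ t ≤ T, StronglyMeasurable[𝓕 t] (X t))
    (hX : ∀ᵐ ω ∂P, ∀ t ≤ T, X t ω = M t ω + ∫ r in 0..(t : ℝ), f r ω) :
    IsSemimartingale (upTo T X) 𝓕 P := by
  have hMT := martingale_upTo hM T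
  have hdrift : ∀ᵐ ω ∂P, (fun t ↦ upTo T X t ω - upTo T M t ω)
      = fun t ↦ ∫ r in 0..((min t T : ℝ≥0) : ℝ), f r ω := by
    filter_upwards [hX] with ω hω
    funext t
    exact sub_eq_of_eq_add' (hω _ (min_le_right t T))
  refine ⟨upTo T M, fun t ω ↦ upTo T X t ω - upTo T M t ω, Locally.of_prop ⟨hMT, ?_⟩,
    ⟨fun t ↦ ?_, ?_, ?_⟩, ae_of_all _ fun ω t ↦ (add_sub_cancel _ _).symm⟩
  · exact hMc.mono fun ω hω ↦ isCadlag_of_continuous (continuous_upTo hω)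
  · exact ((hXm _ (min_le_right t T)).mono (𝓕.mono (min_le_left t T))).sub
      (hMT.stronglyMeasurable t)
  · filter_upwards [hdrift, hf] with ω hω hfω
    exact hω ▸ isCadlag_of_continuous (continuous_primitive_min hfω)
  · filter_upwards [hdrift, hf] with ω hω hfω
    exact hω ▸ (boundedVariationOn_primitive_min hfω).locallyBoundedVariationOn

end Semimartingales

section Dynamics

variable {Ω : Type*} {mΩ : MeasurableSpace Ω} {W X Y : ℝ≥0 → Ω → ℝ} {P : Measure Ω}
  {K g : ℝ → ℝ} {T : ℝ≥0}

theorem continuous_upTo_mul_add_intervalIntegral {ω : Ω} (c : ℝ) (hW : Continuous (W · ω))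
    (hY : IntervalIntegrable (fun r : ℝ ↦ Y r.toNNReal ω) volume 0 T) :
    Continuous (upTo T (fun t ω ↦ c * W t ω + ∫ r in 0..(t : ℝ), Y r.toNNReal ω) · ω) :=
  (continuous_const.mul (continuous_upTo hW)).add (continuous_primitive_min hY)

theorem exists_continuous_isVolterraProcess (hW : IsBrownianReal W P)
    (hK : ∀ s ∈ Icc (0 : ℝ) T, K s = K 0 + ∫ r in 0..s, g r)
    (hg : MemLp g 2 ((volume : Measure ℝ).restrict (Icc 0 (T : ℝ))))
    (hY : IsVolterraProcess hW.toIsPreBrownianReal g T Y)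
    (hYm : Measurable (Function.uncurry Y)) :
    ∃ X : ℝ≥0 → Ω → ℝ, IsVolterraProcess hW.toIsPreBrownianReal K T X ∧
      ∀ᵐ ω ∂P, Continuous (upTo T X · ω) := by
  refine ⟨fun t ω ↦ K 0 * W t ω + ∫ r in 0..(t : ℝ), Y r.toNNReal ω, fun t ht ↦
    (isWienerIntegral_iff_ae_eq_mul_add_intervalIntegral hg hK hY hYm ht).2 .rfl, ?_⟩
  filter_upwards [hW.cont, hY.ae_intervalIntegrable hg hYm] with ω hWω hYω
  exact continuous_upTo_mul_add_intervalIntegral (K 0) hWω hYω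

theorem IsVolterraProcess.ae_forall_eq_mul_add_intervalIntegral (hW : IsBrownianReal W P)
    (hK : ∀ s ∈ Icc (0 : ℝ) T, K s = K 0 + ∫ r in 0..s, g r)
    (hg : MemLp g 2 ((volume : Measure ℝ).restrict (Icc 0 (T : ℝ))))
    (hX : IsVolterraProcess hW.toIsPreBrownianReal K T X)
    (hXc : ∀ᵐ ω ∂P, IsCadlag (upTo T X · ω))
    (hY : IsVolterraProcess hW.toIsPreBrownianReal g T Y)
    (hYm : Measurable (Function.uncurry Y)) :
    ∀ᵐ ω ∂P, ∀ t ≤ T, X t ω = K 0 * W t ω + ∫ r in 0..(t : ℝ), Y r.toNNReal ω := by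
  let Z : ℝ≥0 → Ω → ℝ := fun t ω ↦ K 0 * W t ω + ∫ r in 0..(t : ℝ), Y r.toNNReal ω
  obtain ⟨D, hDc, hD⟩ := TopologicalSpace.exists_countable_dense ℝ≥0
  have hXZ : ∀ᵐ ω ∂P, ∀ t ∈ D, upTo T X t ω = upTo T Z t ω :=
    (ae_ball_iff hDc).2 fun t _ ↦
      (isWienerIntegral_iff_ae_eq_mul_add_intervalIntegral hg hK hY hYm (min_le_right t T)).1
        (hX _ (min_le_right t T))
  filter_upwards [hXZ, hXc, hW.cont, hY.ae_intervalIntegrable hg hYm] with ω hω hXω hWω hYω t ht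
  have hZω : Continuous (upTo T Z · ω) := continuous_upTo_mul_add_intervalIntegral (K 0) hWω hYω
  have hpath := eq_of_eqOn_dense_of_continuousWithinAt_Ici hD (fun t ↦ (hXω t).1)
    (fun _ ↦ hZω.continuousWithinAt) hω
  simpa only [upTo, min_eq_left ht] using congrFun hpath t

end Dynamics

end GaussianVolterra

end

theorem proposition1_general {Ω : Type*} [mΩ : MeasurableSpace Ω] (P : Measure Ω)
    (𝓕 : Filtration ℝ≥0 mΩ) (h𝓕 : ∀ A : Set Ω, P A = 0 → MeasurableSet[𝓕 0] A)
    (W : ℝ≥0 → Ω → ℝ) (hW : GaussianVolterra.IsBrownianMotion W 𝓕 P) (T : ℝ≥0) (K g : ℝ → ℝ)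
    (hK : ∀ s ∈ Set.Icc (0 : ℝ) T, K s = K 0 + ∫ r in (0 : ℝ)..s, g r)
    (hg : MemLp g 2 ((volume : Measure ℝ).restrict (Set.Icc 0 (T : ℝ)))) :
    (∃ X : ℝ≥0 → Ω → ℝ, GaussianVolterra.IsVolterraProcess hW.toIsPreBrownianReal K T X ∧
      ∀ᵐ ω ∂P, Continuous (GaussianVolterra.upTo T X · ω)) ∧
    (∃ Y : ℝ≥0 → Ω → ℝ, GaussianVolterra.IsVolterraProcess hW.toIsPreBrownianReal g T Y ∧
      IsStronglyProgressive 𝓕 Y) ∧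
    ∀ X Y : ℝ≥0 → Ω → ℝ,
      GaussianVolterra.IsVolterraProcess hW.toIsPreBrownianReal K T X →
      (∀ᵐ ω ∂P, GaussianVolterra.IsCadlag (GaussianVolterra.upTo T X · ω)) →
      GaussianVolterra.IsVolterraProcess hW.toIsPreBrownianReal g T Y →
      Measurable (Function.uncurry Y) →
      GaussianVolterra.IsSemimartingale (GaussianVolterra.upTo T X) 𝓕 P ∧
      ∀ᵐ ω ∂P, IntervalIntegrable (fun r : ℝ ↦ Y r.toNNReal ω) volume 0 T ∧
        ∀ t : ℝ≥0, t ≤ T →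
          X t ω = K 0 * W t ω + ∫ r in (0 : ℝ)..t, Y r.toNNReal ω := by
  have := hW.isGaussianProcess.isProbabilityMeasure
  obtain ⟨Y₀, hY₀, hprog⟩ := GaussianVolterra.exists_isStronglyProgressive_isVolterraProcess hg
    hW.toIsPreBrownianReal hW.adapted
  refine ⟨GaussianVolterra.exists_continuous_isVolterraProcess hW.toIsBrownianReal hK hg hY₀
    (GaussianVolterra.measurable_uncurry_of_isStronglyProgressive hprog), ⟨Y₀, hY₀, hprog⟩,
    fun X Y hX hXc hY hYm ↦ ?_⟩
  have hXm (t : ℝ≥0) (ht : t ≤ T) : StronglyMeasurable[𝓕 t] (X t) :=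
    GaussianVolterra.stronglyMeasurable_of_aestronglyMeasurable
      (fun A hA ↦ 𝓕.mono zero_le A (h𝓕 A hA)) ((hX t ht).aestronglyMeasurable hW.adapted)
  have hint := hY.ae_intervalIntegrable hg hYm
  have hdyn := hX.ae_forall_eq_mul_add_intervalIntegral hW.toIsBrownianReal hK hg hXc hY hYm
  exact ⟨GaussianVolterra.isSemimartingale_upTo_of_ae_eq_add_intervalIntegral
    (hW.martingale.smul (K 0)) (hW.cont.mono fun _ hω ↦ continuous_const.mul hω) hint hXm hdyn,
    hint.and hdyn⟩

theorem proposition1 {Ω : Type*} [mΩ : MeasurableSpace Ω] (P : Measure Ω) [IsProbabilityMeasure P]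
    (𝓕 : Filtration ℝ≥0 mΩ) (h𝓕 : GaussianVolterra.UsualConditions 𝓕 P)
    (W : ℝ≥0 → Ω → ℝ) (hW : GaussianVolterra.IsBrownianMotion W 𝓕 P)
    (T : ℝ≥0) (K : ℝ → ℝ) (hK : AbsolutelyContinuousOnInterval K 0 T)
    (hK' : MemLp (deriv K) 2 ((volume : Measure ℝ).restrict (Set.Icc 0 (T : ℝ)))) :
    -- the process `∫_0^t K(t-s) dW_s` exists and has a continuous version on `[0, T]`,
    (∃ X : ℝ≥0 → Ω → ℝ, GaussianVolterra.IsVolterraProcess hW.toIsPreBrownianReal K T X ∧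
      ∀ᵐ ω ∂P, Continuous (GaussianVolterra.upTo T X · ω)) ∧
    -- the drift `∫_0^t K'(t-s) dW_s` exists and has a progressively measurable version,
    (∃ Y : ℝ≥0 → Ω → ℝ, GaussianVolterra.IsVolterraProcess hW.toIsPreBrownianReal (deriv K) T Y ∧
      IsStronglyProgressive 𝓕 Y) ∧
    -- and, whichever versions are taken, `X` is a semimartingale on `[0, T]` with the dynamics
    -- `dX_t = K(0) dW_t + Y_t dt`, `X_0 = 0`.
    ∀ X Y : ℝ≥0 → Ω → ℝ,
      GaussianVolterra.IsVolterraProcess hW.toIsPreBrownianReal K T X →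
      (∀ᵐ ω ∂P, GaussianVolterra.IsCadlag (GaussianVolterra.upTo T X · ω)) →
      GaussianVolterra.IsVolterraProcess hW.toIsPreBrownianReal (deriv K) T Y →
      Measurable (Function.uncurry Y) →
      GaussianVolterra.IsSemimartingale (GaussianVolterra.upTo T X) 𝓕 P ∧
      ∀ᵐ ω ∂P, IntervalIntegrable (fun r : ℝ ↦ Y r.toNNReal ω) volume 0 T ∧
        ∀ t : ℝ≥0, t ≤ T →
          X t ω = K 0 * W t ω + ∫ r in (0 : ℝ)..t, Y r.toNNReal ω := by
  exact proposition1_general P 𝓕 h𝓕.complete W hW T K (deriv K)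
    (fun s hs ↦ GaussianVolterra.eq_add_intervalIntegral_deriv hK (mem_uIcc_of_le hs.1 hs.2)) hK'
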